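/- **Theorem (Conditions for extrapolation).** Let $d\in\mathbb{N}$, $\beta\in\mathbb{R}^d$, and let $g(x)=\beta^\top x$ be the target function. For a constant $c>0$ consider the two-layer ReLU multi-layer perceptron of width $m$ (without bias), $$f_m(\theta,x)=\sqrt{\tfrac{c}{m}}\sum_{r=1}^m a_r\max(0,w_r^\top x),\qquad \theta=(w_r,a_r)_{r\le m},\quad w_r\in\mathbb{R}^d,\ a_r\in\mathbb{R},$$ and its neural tangent kernel $$\mathrm{NTK}(x,x')=\lim_{m\to\infty}\mathbb{E}_{\theta\sim\mathcal N(0,I)}\Big\langle \frac{\partial f_m(\theta,x)}{\partial\theta},\frac{\partial f_m(\theta,x')}{\partial\theta}\Big\rangle ,\qquad x,x'\in\mathbb{R}^d .$$ Training in the NTK regime with squared loss on $\{(x_i,y_i)\}_{i=1}^n$ means gradient descent with infinitesimal steps on $\frac12\sum_i (f(x_i)-y_i)^2$ for an infinitely wide network whose tangent kernel stays equal to $\mathrm{NTK}$ and whose output is zero at the start, i.e. $$F_0(x)=0,\qquad \frac{d}{dt}F_t(x)=-\sum_{i=1}^n \mathrm{NTK}(x,x_i)\,\big(F_t(x_i)-y_i\big)\qquad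 (t\ge 0,\ x\in\mathbb{R}^d),$$ and the learned function is $f(x)=\lim_{t\to\infty}F_t(x)$. Let $x_1,x_2,\dots$ be independent samples from a probability distribution on $\mathbb{R}^d$ whose support contains a connected subset $\mathcal S$ such that for every non-zero $w\in\mathbb{R}^d$ there is $k>0$ with $kw\in\mathcal S$, and let $y_i=\beta^\top x_i$. Then for every $n$ the function $f_n$ learned by the two-layer ReLU MLP on $\{(x_i,y_i)\}_{i=1}^n$ with squared loss in the NTK regime exists and is unique, and for every $x\in\mathbb{R}^d$, $f_n(x)\to\beta^\top x$ in probability as $n\to\infty$. -/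

import Mathlib

open MeasureTheory ProbabilityTheory Filter
open scoped Topology

namespace ReLUNTK

/-- Parameters of a two-layer network with `m` hidden units on `ℝ^d`: the coordinate `inl (r, j)`
is the `j`-th entry of the weight vector `w_r` of the `r`-th hidden unit, and the coordinate
`inr r` is its output weight `a_r`. -/
abbrev Param (d m : ℕ) : Type := EuclideanSpace ℝ ((Fin m × Fin d) ⊕ Fin m)

/-- The two-layer ReLU multi-layer perceptron
`x ↦ √(c / m) * ∑ r, a_r * max 0 (w_rᵀ x)` of width `m`, with scaling constant `c`. -/
noncomputable def mlp (c : ℝ) {d m : ℕ} (θ : Param d m) (x : EuclideanSpace ℝ (Fin d)) : ℝ :=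
  Real.sqrt (c / m) *
    ∑ r : Fin m, θ (Sum.inr r) * max 0 (∑ j : Fin d, θ (Sum.inl (r, j)) * x j)

/-- The tangent kernel at the parameter `θ`: the inner product `⟨∂f(θ, x)/∂θ, ∂f(θ, x')/∂θ⟩`
of the gradients with respect to all parameters. -/
noncomputable def tangentKernel (c : ℝ) {d m : ℕ} (θ : Param d m)
    (x x' : EuclideanSpace ℝ (Fin d)) : ℝ :=
  inner ℝ (gradient (fun η : Param d m => mlp c η x) θ)
    (gradient (fun η : Param d m => mlp c η x') θ)

/-- `K` is the neural tangent kernel of the two-layer ReLU MLP: the infinite-width limit of the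
expected tangent kernel at random initialization, all parameters being independent standard
Gaussians. -/
def IsNTK (c : ℝ) (d : ℕ)
    (K : EuclideanSpace ℝ (Fin d) → EuclideanSpace ℝ (Fin d) → ℝ) : Prop :=
  ∀ x x', Tendsto (fun m : ℕ => ∫ θ, tangentKernel c θ x x' ∂(stdGaussian (Param d m)))
    atTop (𝓝 (K x x'))

/-- `F t x` is the output at time `t ≥ 0` and input `x` of gradient descent with infinitesimal
steps on the squared loss `(1 / 2) * ∑ i, (f (x_i) - y_i) ^ 2` when the tangent kernel stays equal
to `K` during training: the output is zero at the start and
`d/dt F t x = - ∑ i, K x x_i * (F t x_i - y_i)`. -/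
def IsKernelGradientFlow {d n : ℕ}
    (K : EuclideanSpace ℝ (Fin d) → EuclideanSpace ℝ (Fin d) → ℝ)
    (X : Fin n → EuclideanSpace ℝ (Fin d)) (y : Fin n → ℝ)
    (F : ℝ → EuclideanSpace ℝ (Fin d) → ℝ) : Prop :=
  (∀ x, F 0 x = 0) ∧
    ∀ x, ∀ t, 0 ≤ t → HasDerivWithinAt (fun s => F s x)
      (-∑ i, K x (X i) * (F t (X i) - y i)) (Set.Ici 0) t

/-- `f` is the function learned at convergence (`t → ∞`) by the two-layer ReLU MLP trained in the
NTK regime with squared loss on the training set `(X i, y i)`. -/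
def IsLearned (c : ℝ) {d n : ℕ} (X : Fin n → EuclideanSpace ℝ (Fin d)) (y : Fin n → ℝ)
    (f : EuclideanSpace ℝ (Fin d) → ℝ) : Prop :=
  ∃ K, IsNTK c d K ∧ ∃ F, IsKernelGradientFlow K X y F ∧
    ∀ x, Tendsto (fun t => F t x) atTop (𝓝 (f x))

end ReLUNTK

namespace ReLUNTK

/-! The argument is a projection argument in the feature space of the kernel. A tangent kernel of
width `m` is an average of width-one kernels over the hidden units, so its expectation is the same
for all `m > 0`, and the NTK is the Gram kernel of `ntkFeature`: the gradient `φ x` of a single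
unit, as an element of L² of the Gaussian.

Linear functions have the form `x ↦ ⟪φ x, h⟫`: each half-space of weights carries half of the second
moment of the output weight `a`, so it suffices to pair `φ x` with a multiple of `a β`
(`exists_inner_ntkFeature_eq`). The flow started at zero stays in the span of the training features
and converges to the projection of `h` onto it (`isLearned_iff`), even for repeated points or
dependent features. Hence the error at `x` is at most `‖φ x‖` times the distance from `h` to that
span.

Almost surely the sample is dense in the support, which meets every open ray. Since `φ` is
continuous and positively homogeneous, the sample features then span a dense subspace of the closed
span of all features. That closed span may be taken to contain `h`, so the distance tends to zero.
-/

/-! ### Kernel gradient flow: convergence and uniqueness. -/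

/-- A symmetric positive definite quadratic gradient flow on a finite-dimensional space, started
at `0`, converges to its target. -/
theorem exists_linear_flow {V : Type*} [NormedAddCommGroup V] [InnerProductSpace ℝ V]
    [FiniteDimensional ℝ V] (T : V →ₗ[ℝ] V) (hT : T.IsSymmetric)
    (hpos : ∀ v, v ≠ 0 → 0 < inner ℝ v (T v)) (p : V) :
    ∃ Θ : ℝ → V, Θ 0 = 0 ∧ (∀ t, HasDerivAt Θ (-T (Θ t - p)) t) ∧
      Tendsto Θ atTop (𝓝 p) := by
  set b := hT.eigenvectorBasis rfl
  set l := hT.eigenvalues rfl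
  have hb : ∀ i, T (b i) = l i • b i := fun i => hT.apply_eigenvectorBasis rfl i
  have hl : ∀ i, 0 < l i := fun i => by
    have h := hpos (b i) (b.orthonormal.ne_zero i)
    rw [hb, inner_smul_right, real_inner_self_eq_norm_sq, b.orthonormal.1 i] at h
    simpa using h
  have hp : p = ∑ i, inner ℝ (b i) p • b i := (b.sum_repr' p).symm
  -- In the eigenbasis the equation decouples into `u' = -l i * (u - p_i)` with `u 0 = 0`.
  refine ⟨fun t => ∑ i, ((1 - Real.exp (-(l i * t))) * inner ℝ (b i) p) • b i, by simp,
    fun t => ?_, ?_⟩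
  · have h1 : (∑ i, ((1 - Real.exp (-(l i * t))) * inner ℝ (b i) p) • b i) - p
        = ∑ i, (-Real.exp (-(l i * t)) * inner ℝ (b i) p) • b i := by
      conv_lhs => rw [hp]
      rw [← Finset.sum_sub_distrib]
      refine Finset.sum_congr rfl fun i _ => ?_
      rw [← hp, ← sub_smul]
      ring_nf
    rw [h1, map_sum, ← Finset.sum_neg_distrib]
    refine HasDerivAt.fun_sum fun i _ => ?_
    rw [map_smul, hb, smul_smul, ← neg_smul]
    refine HasDerivAt.smul_const ?_ _
    have h2 : HasDerivAt (fun t => -(l i * t)) (-l i) t := by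
      simpa using ((hasDerivAt_id t).const_mul (l i)).fun_neg
    refine ((h2.exp.const_sub 1).mul_const (inner ℝ (b i) p)).congr_deriv ?_
    ring
  · conv => rw [hp]
    refine tendsto_finsetSum _ fun i _ => ?_
    refine Tendsto.smul_const ?_ _
    rw [← hp]
    have h3 : Tendsto (fun t => Real.exp (-(l i * t))) atTop (𝓝 0) :=
      Real.tendsto_exp_neg_atTop_nhds_zero.comp (tendsto_id.const_mul_atTop (hl i))
    simpa using (h3.const_sub 1).mul_const (inner ℝ (b i) p)

variable {d n : ℕ} {H : Type*} [NormedAddCommGroup H] [InnerProductSpace ℝ H]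

/-- `H` need not be complete; a finite-dimensional span is. -/
instance hasOrthogonalProjection_span_range {ι : Type*} [Finite ι] (v : ι → H) :
    (Submodule.span ℝ (Set.range v)).HasOrthogonalProjection :=
  have := FiniteDimensional.span_of_finite ℝ (Set.finite_range v)
  inferInstance

/-- For a kernel with feature map `φ` and labels `⟪φ (X i), h⟫`, the kernel gradient flow
converges to the function represented by the orthogonal projection of `h` onto the span of the
features of the training points. -/
theorem exists_isKernelGradientFlow (φ : EuclideanSpace ℝ (Fin d) → H) (h : H)
    (X : Fin n → EuclideanSpace ℝ (Fin d)) :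
    ∃ F, IsKernelGradientFlow (fun x x' => inner ℝ (φ x) (φ x')) X
        (fun i => inner ℝ (φ (X i)) h) F ∧
      ∀ x, Tendsto (fun t => F t x) atTop
        (𝓝 (inner ℝ (φ x) ((Submodule.span ℝ (Set.range fun i => φ (X i))).starProjection h))) := by
  set V := Submodule.span ℝ (Set.range fun i => φ (X i)) with hV
  have : FiniteDimensional ℝ V := FiniteDimensional.span_of_finite ℝ (Set.finite_range _)
  let e : Fin n → V := fun i => ⟨φ (X i), Submodule.subset_span ⟨i, rfl⟩⟩
  -- The flow is lifted to feature space as `F t x = ⟪φ x, Θ t⟫`. On the span `V` the operator `T`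
  -- is definite, since a vector of `V` orthogonal to all generators is zero.
  let T : V →ₗ[ℝ] V := ∑ i, (innerₛₗ ℝ (e i)).smulRight (e i)
  have hTv : ∀ v, T v = ∑ i, inner ℝ (e i) v • e i := fun v => by
    simp [T, LinearMap.sum_apply]
  have hTin : ∀ u v, inner ℝ u (T v) = ∑ i, inner ℝ (e i) u * inner ℝ (e i) v := fun u v => by
    rw [hTv, inner_sum]
    refine Finset.sum_congr rfl fun i _ => ?_
    rw [inner_smul_right, real_inner_comm u, mul_comm]
  have hsym : T.IsSymmetric := fun u v => by
    rw [hTin, real_inner_comm, hTin]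
    exact Finset.sum_congr rfl fun i _ => mul_comm _ _
  have hpos : ∀ v, v ≠ 0 → 0 < inner ℝ v (T v) := fun v hv => by
    rw [hTin]
    refine (Finset.sum_nonneg fun i _ => mul_self_nonneg _).lt_of_ne' fun h0 => hv ?_
    rw [Finset.sum_eq_zero_iff_of_nonneg fun i _ => mul_self_nonneg _] at h0
    have h1 : ∀ w ∈ V, inner ℝ w (v : H) = 0 := by
      intro w hw
      induction hw using Submodule.span_induction with
      | mem w hw =>
        obtain ⟨i, rfl⟩ := hw
        exact mul_self_eq_zero.1 (h0 i (Finset.mem_univ i))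
      | zero => simp
      | add a b _ _ ha hb => rw [inner_add_left, ha, hb, add_zero]
      | smul r a _ ha => rw [inner_smul_left, ha, mul_zero]
    exact Subtype.ext (inner_self_eq_zero.1 (h1 v v.2))
  set p : V := V.orthogonalProjectionOnto h
  have hep : ∀ i, inner ℝ (φ (X i)) (p : H) = inner ℝ (φ (X i)) h := fun i => by
    have := V.starProjection_inner_eq_zero h (φ (X i)) (e i).2
    rw [inner_sub_left, sub_eq_zero] at this
    rw [real_inner_comm, real_inner_comm h]
    exact this.symm
  obtain ⟨Θ, h0, hd, hlim⟩ := exists_linear_flow T hsym hpos p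
  refine ⟨fun t x => inner ℝ (φ x) (Θ t : H), ⟨fun x => by simp [h0], fun x t _ => ?_⟩,
    fun x => ?_⟩
  · have h1 : HasDerivAt (fun s => (Θ s : H)) ((-T (Θ t - p) : V) : H) t :=
      (V.subtypeL.hasFDerivAt.comp_hasDerivAt t (hd t))
    have h2 := ((innerSL ℝ (φ x)).hasFDerivAt.comp_hasDerivAt t h1)
    refine (h2.congr_deriv ?_).hasDerivWithinAt
    rw [hTv]
    simp only [innerSL_apply_apply, Submodule.coe_neg, Submodule.coe_sum, Submodule.coe_smul,
      inner_neg_right, inner_sum, inner_smul_right]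
    congr 1
    refine Finset.sum_congr rfl fun i _ => ?_
    rw [← hep i, mul_comm, inner_sub_right]
    rfl
  · exact ((innerSL ℝ (φ x)).continuous.comp V.subtypeL.continuous).continuousAt.tendsto.comp hlim

/-- The kernel gradient flow of a kernel with a feature map is unique for `t ≥ 0`. -/
theorem IsKernelGradientFlow.eq {φ : EuclideanSpace ℝ (Fin d) → H}
    {X : Fin n → EuclideanSpace ℝ (Fin d)} {y : Fin n → ℝ}
    {F G : ℝ → EuclideanSpace ℝ (Fin d) → ℝ}
    (hF : IsKernelGradientFlow (fun x x' => inner ℝ (φ x) (φ x')) X y F)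
    (hG : IsKernelGradientFlow (fun x x' => inner ℝ (φ x) (φ x')) X y G)
    {t : ℝ} (ht : 0 ≤ t) (x : EuclideanSpace ℝ (Fin d)) : F t x = G t x := by
  set D : ℝ → EuclideanSpace ℝ (Fin d) → ℝ := fun t x => F t x - G t x with hD
  have hD0 : ∀ x, D 0 x = 0 := fun x => by simp [hD, hF.1, hG.1]
  have hDd : ∀ x, ∀ t, 0 ≤ t → HasDerivWithinAt (fun s => D s x)
      (-∑ i, inner ℝ (φ x) (φ (X i)) * D t (X i)) (Set.Ici 0) t := fun x t ht => by
    refine ((hF.2 x t ht).sub (hG.2 x t ht)).congr_deriv ?_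
    rw [neg_sub_neg, ← Finset.sum_sub_distrib, ← Finset.sum_neg_distrib]
    refine Finset.sum_congr rfl fun i _ => ?_
    simp only [hD]
    ring
  -- Energy argument: positivity of the Gram kernel makes the squared difference on the training
  -- points nonincreasing, and it starts at zero. The derivative of `D` then vanishes at every
  -- input.
  have hE : AntitoneOn (fun t => ∑ i, D t (X i) ^ 2) (Set.Ici 0) := by
    have hder : ∀ t, 0 ≤ t → HasDerivWithinAt (fun t => ∑ i, D t (X i) ^ 2)
        (-2 * ‖∑ i, D t (X i) • φ (X i)‖ ^ 2) (Set.Ici 0) t := fun t ht => by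
      have h1 := HasDerivWithinAt.fun_sum (u := Finset.univ)
        fun (i : Fin n) _ => (hDd (X i) t ht).fun_pow 2
      refine h1.congr_deriv ?_
      rw [← real_inner_self_eq_norm_sq, sum_inner, Finset.mul_sum]
      refine Finset.sum_congr rfl fun i _ => ?_
      rw [inner_smul_left, inner_sum]
      simp only [inner_smul_right, conj_trivial]
      simp only [mul_comm (D t (X _)) (inner ℝ _ _)]
      push_cast
      ring
    refine antitoneOn_of_hasDerivWithinAt_nonpos (convex_Ici 0)
      (fun t ht => (hder t ht).continuousWithinAt)
      (fun t ht => (hder t (interior_subset ht)).mono interior_subset) fun t _ => ?_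
    nlinarith [sq_nonneg ‖∑ i, D t (X i) • φ (X i)‖]
  have hDX : ∀ t, 0 ≤ t → ∀ i, D t (X i) = 0 := fun t ht i => by
    have h1 : ∑ i, D t (X i) ^ 2 ≤ ∑ i, D 0 (X i) ^ 2 := hE Set.self_mem_Ici ht ht
    simp only [hD0] at h1
    have h2 : D t (X i) ^ 2 ≤ ∑ i, D t (X i) ^ 2 :=
      Finset.single_le_sum (f := fun i => D t (X i) ^ 2) (fun i _ => sq_nonneg _)
        (Finset.mem_univ i)
    have : D t (X i) ^ 2 ≤ 0 := h2.trans (by simpa using h1)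
    exact pow_eq_zero_iff two_ne_zero |>.1 (le_antisymm this (sq_nonneg _))
  have hconst := constant_of_has_deriv_right_zero (f := fun s => D s x) (a := 0) (b := t)
    (fun s hs => ((hDd x s hs.1).continuousWithinAt).mono Set.Icc_subset_Ici_self)
    (fun s hs => by
      have := (hDd x s hs.1).mono (Set.Ici_subset_Ici.2 hs.1)
      simpa [hDX s hs.1] using this) t ⟨ht, le_rfl⟩
  rw [hD0] at hconst
  exact sub_eq_zero.1 hconst

/-! ### Gaussian parameters and the almost everywhere gradient. -/

/-- Coordinate marginals of the standard Gaussian are standard Gaussian. -/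
theorem stdGaussian_map_reindex {ι κ : Type*} [Fintype ι] [Fintype κ] (f : κ → ι)
    (hf : Function.Injective f) :
    (stdGaussian (EuclideanSpace ℝ ι)).map (fun x => (WithLp.toLp 2 fun k => x (f k) :
      EuclideanSpace ℝ κ)) = stdGaussian (EuclideanSpace ℝ κ) := by
  classical
  have hm : Measurable fun x : EuclideanSpace ℝ ι =>
    (WithLp.toLp 2 fun k => x (f k) : EuclideanSpace ℝ κ) := by fun_prop
  have := Measure.isProbabilityMeasure_map (μ := stdGaussian (EuclideanSpace ℝ ι)) hm.aemeasurable
  refine Measure.ext_of_charFun ?_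
  ext t
  -- The extension of `t` by zero along `f` has the norm of `t`, and the Gaussian characteristic
  -- function depends only on the norm.
  let e : EuclideanSpace ℝ ι := WithLp.toLp 2 fun i => ∑ k, if f k = i then t k else 0
  have he : ∀ x : EuclideanSpace ℝ ι,
      inner ℝ (WithLp.toLp 2 fun k => x (f k) : EuclideanSpace ℝ κ) t = inner ℝ x e := fun x => by
    simp only [PiLp.inner_apply, e, RCLike.inner_apply, conj_trivial, Finset.sum_mul]
    rw [Finset.sum_comm]
    simp [ite_mul]
  have hne : ‖e‖ ^ 2 = ‖t‖ ^ 2 := by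
    rw [← real_inner_self_eq_norm_sq, ← he, ← real_inner_self_eq_norm_sq]
    congr 1
    ext k
    simp [e, hf.eq_iff]
  rw [charFun_apply, integral_map hm.aemeasurable (by fun_prop), charFun_stdGaussian,
    ← Complex.ofReal_pow, ← hne, Complex.ofReal_pow,
    ← charFun_stdGaussian, charFun_apply]
  simp only [he]

variable {m : ℕ}

/-- The pre-activation `w_rᵀ x` of the `r`-th hidden unit. -/
def preact (θ : Param d m) (x : EuclideanSpace ℝ (Fin d)) (r : Fin m) : ℝ :=
  ∑ j : Fin d, θ (Sum.inl (r, j)) * x j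

/-- The gradient of the network, with the derivative of the ReLU at `0` set to `0`. -/
noncomputable def mlpGrad (c : ℝ) (θ : Param d m) (x : EuclideanSpace ℝ (Fin d)) : Param d m :=
  WithLp.toLp 2 fun i => Real.sqrt (c / m) * i.elim
    (fun p => θ (Sum.inr p.1) * (if 0 < preact θ x p.1 then 1 else 0) * x p.2)
    (fun r => max 0 (preact θ x r))

theorem measurable_preact (x : EuclideanSpace ℝ (Fin d)) (r : Fin m) :
    Measurable fun θ : Param d m => preact θ x r := by
  unfold preact; fun_prop

theorem continuous_preact (θ : Param d m) (r : Fin m) :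
    Continuous fun x : EuclideanSpace ℝ (Fin d) => preact θ x r := by
  unfold preact; fun_prop

theorem measurable_mlpGrad (c : ℝ) (x : EuclideanSpace ℝ (Fin d)) :
    Measurable fun θ : Param d m => mlpGrad c θ x := by
  refine (PiLp.continuous_toLp 2 _).measurable.comp (measurable_pi_lambda _ fun i => ?_)
  refine Measurable.const_mul ?_ _
  have := fun r => measurable_preact (m := m) x r
  rcases i with ⟨r, j⟩ | r
  · refine Measurable.mul_const (Measurable.mul (by fun_prop) ?_) _
    exact Measurable.ite (measurableSet_lt measurable_const (this r)) measurable_const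
      measurable_const
  · exact measurable_const.max (this r)

/-- The pre-activation is a Gaussian variable of variance `‖x‖ ^ 2`, which has no atoms. -/
theorem ae_preact_ne_zero {x : EuclideanSpace ℝ (Fin d)} (hx : x ≠ 0) (r : Fin m) :
    ∀ᵐ θ ∂(stdGaussian (Param d m)), preact θ x r ≠ 0 := by
  let u : Param d m := WithLp.toLp 2 fun i => i.elim (fun p => if p.1 = r then x p.2 else 0) 0
  have hu : u ≠ 0 := fun h => hx <| by
    ext j
    simpa [u] using congrArg (fun v : Param d m => v (Sum.inl (r, j))) h
  have hL : ∀ θ : Param d m, preact θ x r = innerSL ℝ u θ := fun θ => by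
    simp [preact, u, PiLp.inner_apply, Fintype.sum_prod_type, Finset.sum_ite_irrel]
  have hmap := IsGaussian.map_eq_gaussianReal (μ := stdGaussian (Param d m)) (innerSL ℝ u)
  have hv : (Var[innerSL ℝ u; stdGaussian (Param d m)]).toNNReal ≠ 0 := by
    rw [variance_dual_stdGaussian, innerSL_apply_norm]
    simpa using hu
  have hne : ∀ᵐ z ∂((stdGaussian (Param d m)).map (innerSL ℝ u)), z ≠ 0 := by
    rw [hmap]
    have := nullSingletonClass_gaussianReal (μ := (stdGaussian (Param d m))[innerSL ℝ u]) hv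
    exact Measure.ae_ne _ _
  filter_upwards [ae_of_ae_map (by fun_prop) hne] with θ hθ
  rwa [hL]

/-- Away from the kinks the activation pattern `s` is locally constant, so the network is locally a
polynomial in the parameters. -/
theorem hasGradientAt_mlp (c : ℝ) {θ : Param d m} {x : EuclideanSpace ℝ (Fin d)}
    (hθ : ∀ r, preact θ x r ≠ 0) :
    HasGradientAt (fun η : Param d m => mlp c η x) (mlpGrad c θ x) θ := by
  let s : Fin m → ℝ := fun r => if 0 < preact θ x r then 1 else 0
  have hs : (fun η : Param d m => mlp c η x) =ᶠ[𝓝 θ] fun η =>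
      Real.sqrt (c / m) * ∑ r, η (Sum.inr r) * (s r * preact η x r) := by
    have h : ∀ r, ∀ᶠ η : Param d m in 𝓝 θ, max 0 (preact η x r) = s r * preact η x r := fun r => by
      have hc : Continuous fun η : Param d m => preact η x r := by unfold preact; fun_prop
      rcases (hθ r).lt_or_gt with h | h
      · filter_upwards [hc.continuousAt.eventually (gt_mem_nhds h)] with η hη
        simp [s, h.not_gt, hη.le]
      · filter_upwards [hc.continuousAt.eventually (lt_mem_nhds h)] with η hη
        simp [s, h, hη.le]
    filter_upwards [eventually_all.2 h] with η hη
    simp only [mlp, ← hη]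
    rfl
  refine HasGradientAt.congr_of_eventuallyEq ?_ hs
  rw [hasGradientAt_iff_hasFDerivAt]
  have hcoord : ∀ i, HasFDerivAt (fun η : Param d m => η i)
      (EuclideanSpace.proj i : Param d m →L[ℝ] ℝ) θ := fun i =>
    (EuclideanSpace.proj i : Param d m →L[ℝ] ℝ).hasFDerivAt
  have hpre : ∀ r, HasFDerivAt (fun η : Param d m => preact η x r)
      (∑ j, x j • (EuclideanSpace.proj (Sum.inl (r, j)) : Param d m →L[ℝ] ℝ)) θ := fun r =>
    HasFDerivAt.fun_sum fun j _ => (hcoord (Sum.inl (r, j))).mul_const (x j)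
  have hmain := (HasFDerivAt.fun_sum (u := Finset.univ) fun r _ =>
    (hcoord (Sum.inr r)).mul ((hpre r).const_mul (s r))).const_mul (Real.sqrt (c / m))
  refine hmain.congr_fderiv ?_
  ext v
  simp only [InnerProductSpace.toDual_apply_apply, PiLp.inner_apply, Fintype.sum_sum_type,
    Fintype.sum_prod_type, mlpGrad, RCLike.inner_apply, conj_trivial, Sum.elim_inl, Sum.elim_inr,
    _root_.smul_apply, _root_.sum_apply, _root_.add_apply,
    smul_eq_mul, PiLp.proj_apply]
  rw [← Finset.sum_add_distrib, Finset.mul_sum]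
  refine Finset.sum_congr rfl fun r _ => ?_
  have hr : max 0 (preact θ x r) = s r * preact θ x r := by
    rcases (hθ r).lt_or_gt with h | h
    · simp [s, h.not_gt, h.le]
    · simp [s, h, h.le]
  rw [hr, mul_add, Finset.mul_sum, Finset.mul_sum, Finset.mul_sum]
  congr 1
  · refine Finset.sum_congr rfl fun j _ => ?_
    simp only [s]
    ring
  · ring

theorem ae_gradient_mlp (c : ℝ) (x : EuclideanSpace ℝ (Fin d)) :
    ∀ᵐ θ ∂(stdGaussian (Param d m)),
      gradient (fun η : Param d m => mlp c η x) θ = mlpGrad c θ x := by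
  rcases eq_or_ne x 0 with rfl | hx
  -- At `x = 0` every pre-activation sits at the kink, but the network is identically zero.
  · refine Eventually.of_forall fun θ => ?_
    have h0 : mlpGrad c θ 0 = 0 := by
      ext i
      rcases i with p | r <;> simp [mlpGrad, preact]
    have h1 : (fun η : Param d m => mlp c η 0) = fun _ => 0 := by
      ext η
      simp [mlp]
    rw [h0, h1]
    exact gradient_const _ _
  · filter_upwards [ae_all_iff.2 fun r => ae_preact_ne_zero hx r] with θ hθ
    exact (hasGradientAt_mlp c hθ).gradient

/-! ### Reduction to one hidden unit; the feature map. -/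

/-- The parameters of the `r`-th hidden unit. -/
noncomputable def unitParam (r : Fin m) (θ : Param d m) : Param d 1 :=
  WithLp.toLp 2 fun k => θ (Sum.map (Prod.map (fun _ => r) id) (fun _ => r) k)

theorem measurePreserving_unitParam (r : Fin m) :
    MeasurePreserving (unitParam r) (stdGaussian (Param d m)) (stdGaussian (Param d 1)) where
  measurable := by unfold unitParam; fun_prop
  map_eq := by
    refine stdGaussian_map_reindex _ (Function.Injective.sumMap (Function.Injective.prodMap ?_
      Function.injective_id) ?_) <;> exact Function.injective_of_subsingleton _

theorem inner_mlpGrad {c : ℝ} (hc : 0 ≤ c) (θ : Param d m) (x x' : EuclideanSpace ℝ (Fin d)) :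
    inner ℝ (mlpGrad c θ x) (mlpGrad c θ x') =
      ∑ r, (1 / m : ℝ) *
        inner ℝ (mlpGrad c (unitParam r θ) x) (mlpGrad c (unitParam r θ) x') := by
  have hsq : Real.sqrt (c / m) * Real.sqrt (c / m) = 1 / m * (Real.sqrt c * Real.sqrt c) := by
    rw [Real.mul_self_sqrt (by positivity), Real.mul_self_sqrt hc]; ring
  have hpre : ∀ (r : Fin m) (z : EuclideanSpace ℝ (Fin d)),
    preact (unitParam r θ) z 0 = preact θ z r := fun r z => rfl
  have ha : ∀ r : Fin m, (unitParam r θ) (Sum.inr 0) = θ (Sum.inr r) := fun r => rfl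
  simp only [PiLp.inner_apply, Fintype.sum_sum_type, Fintype.sum_prod_type, mlpGrad,
    RCLike.inner_apply, conj_trivial, Sum.elim_inl, Sum.elim_inr, Fin.isValue, hpre, ha, Nat.cast_one,
    div_one, Fin.default_eq_zero, Finset.univ_unique, Finset.sum_singleton]
  rw [← Finset.sum_add_distrib]
  refine Finset.sum_congr rfl fun r _ => ?_
  rw [mul_add, Finset.mul_sum]
  congr 1
  · refine Finset.sum_congr rfl fun j _ => ?_
    linear_combination (θ (Sum.inr r) * (if 0 < preact θ x' r then 1 else 0) * x' j *
      (θ (Sum.inr r) * (if 0 < preact θ x r then 1 else 0) * x j)) * hsq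
  · linear_combination (max 0 (preact θ x r) * max 0 (preact θ x' r)) * hsq

/-- This linear bound in `θ` yields both square integrability and the dominating function for
continuity of the features. -/
theorem norm_mlpGrad_le {c : ℝ} (hc : 0 ≤ c) (θ : Param d 1) (x : EuclideanSpace ℝ (Fin d)) :
    ‖mlpGrad c θ x‖ ≤ Real.sqrt c * ‖x‖ * ‖θ‖ := by
  refine le_of_sq_le_sq ?_ (by positivity)
  have hcs : (preact θ x 0) ^ 2 ≤ (∑ j, θ (Sum.inl (0, j)) ^ 2) * ∑ j, x j ^ 2 :=
    Finset.sum_mul_sq_le_sq_mul_sq _ _ _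
  have hmax : max 0 (preact θ x 0) ^ 2 ≤ preact θ x 0 ^ 2 := by
    rcases le_total 0 (preact θ x 0) with h | h
    · simp [h]
    · simp [h, sq_nonneg]
  have hstep : ∀ j, (θ (Sum.inr 0) * (if 0 < preact θ x 0 then 1 else 0) * x j) ^ 2
      ≤ θ (Sum.inr 0) ^ 2 * x j ^ 2 := fun j => by
    split_ifs
    · exact le_of_eq (by ring)
    · simp; positivity
  rw [mul_pow, mul_pow, Real.sq_sqrt hc, EuclideanSpace.real_norm_sq_eq,
    EuclideanSpace.real_norm_sq_eq, EuclideanSpace.real_norm_sq_eq]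
  simp only [Fintype.sum_sum_type, Fintype.sum_prod_type, mlpGrad, Sum.elim_inl, Sum.elim_inr,
    Finset.univ_unique, Finset.sum_singleton, Fin.default_eq_zero, Fin.isValue, Nat.cast_one,
    div_one]
  have h1 := Finset.sum_le_sum fun j (_ : j ∈ Finset.univ) => hstep j
  rw [← Finset.mul_sum] at h1
  simp only [mul_pow (Real.sqrt c), Real.sq_sqrt hc]
  rw [← Finset.mul_sum, ← mul_add, mul_assoc]
  refine mul_le_mul_of_nonneg_left ?_ hc
  nlinarith

theorem memLp_mlpGrad {c : ℝ} (hc : 0 ≤ c) (x : EuclideanSpace ℝ (Fin d)) :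
    MemLp (fun θ : Param d 1 => mlpGrad c θ x) 2 (stdGaussian (Param d 1)) :=
  (IsGaussian.memLp_two_id (μ := stdGaussian (Param d 1))).of_le_mul
    (measurable_mlpGrad c x).aestronglyMeasurable
    (Eventually.of_forall fun θ => norm_mlpGrad_le hc θ x)

/-- The feature map of the neural tangent kernel. -/
noncomputable def ntkFeature (c : ℝ) (hc : 0 ≤ c) (x : EuclideanSpace ℝ (Fin d)) :
    Lp (Param d 1) 2 (stdGaussian (Param d 1)) :=
  (memLp_mlpGrad hc x).toLp

theorem inner_toLp {α F : Type*} [MeasurableSpace α] {μ : Measure α} [NormedAddCommGroup F]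
    [InnerProductSpace ℝ F] {f g : α → F} (hf : MemLp f 2 μ) (hg : MemLp g 2 μ) :
    inner ℝ (hf.toLp f) (hg.toLp g) = ∫ a, inner ℝ (f a) (g a) ∂μ := by
  rw [L2.inner_def]
  refine integral_congr_ae ?_
  filter_upwards [hf.coeFn_toLp, hg.coeFn_toLp] with a h1 h2
  rw [h1, h2]

/-- The neural tangent kernel is the Gram kernel of `ntkFeature`. -/
theorem isNTK_inner_ntkFeature {c : ℝ} (hc : 0 ≤ c) :
    IsNTK c d fun x x' => inner ℝ (ntkFeature c hc x) (ntkFeature c hc x') := fun x x' => by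
  refine tendsto_const_nhds.congr' ?_
  filter_upwards [eventually_gt_atTop 0] with m hm
  have hint : Integrable (fun θ : Param d 1 => inner ℝ (mlpGrad c θ x) (mlpGrad c θ x'))
      (stdGaussian (Param d 1)) := by
    refine (L2.integrable_inner (𝕜 := ℝ) (ntkFeature c hc x) (ntkFeature c hc x')).congr ?_
    filter_upwards [(memLp_mlpGrad hc x).coeFn_toLp, (memLp_mlpGrad hc x').coeFn_toLp]
      with a h1 h2
    simp only [ntkFeature]
    rw [h1, h2]
  have h1 : ∫ θ, tangentKernel c θ x x' ∂(stdGaussian (Param d m)) =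
      ∫ θ, ∑ r, (1 / m : ℝ) * inner ℝ (mlpGrad c (unitParam r θ) x)
        (mlpGrad c (unitParam r θ) x') ∂(stdGaussian (Param d m)) := by
    refine integral_congr_ae ?_
    filter_upwards [ae_gradient_mlp c x, ae_gradient_mlp c x'] with θ h1 h2
    rw [tangentKernel, h1, h2, inner_mlpGrad hc]
  have h2 : ∀ r : Fin m, ∫ θ, inner ℝ (mlpGrad c (unitParam r θ) x)
        (mlpGrad c (unitParam r θ) x') ∂(stdGaussian (Param d m)) =
      inner ℝ (ntkFeature c hc x) (ntkFeature c hc x') := fun r => by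
    rw [ntkFeature, ntkFeature, inner_toLp, ← (measurePreserving_unitParam r).map_eq,
      integral_map (measurePreserving_unitParam r).measurable.aemeasurable
      ((measurable_mlpGrad c x).inner (measurable_mlpGrad c x')).aestronglyMeasurable]
  rw [h1, integral_finsetSum]
  · simp only [integral_const_mul, h2]
    have : (m : ℝ) ≠ 0 := by positivity
    simp [this]
  · exact fun r _ =>
      ((measurePreserving_unitParam r).integrable_comp_of_integrable hint).const_mul _

/-! ### Homogeneity and continuity of the features. -/

/-- A positive factor preserves the activation pattern. Hence one point on each ray determines the
features along it. -/
theorem ntkFeature_smul {c : ℝ} (hc : 0 ≤ c) {k : ℝ} (hk : 0 < k) (x : EuclideanSpace ℝ (Fin d)) :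
    ntkFeature c hc (k • x) = k • ntkFeature c hc x := by
  have h : (fun θ : Param d 1 => mlpGrad c θ (k • x)) = k • fun θ => mlpGrad c θ x := by
    ext θ i
    have hp : ∀ r, preact θ (k • x) r = k * preact θ x r := fun r => by
      simp only [preact, PiLp.smul_apply, smul_eq_mul, Finset.mul_sum]
      exact Finset.sum_congr rfl fun j _ => by ring
    have hmx : ∀ z : ℝ, max 0 (k * z) = k * max 0 z := fun z => by
      rw [mul_max_of_nonneg _ _ hk.le, mul_zero]
    rcases i with p | r
    · simp only [mlpGrad, hp, mul_pos_iff_of_pos_left hk, Sum.elim_inl, PiLp.smul_apply,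
        smul_eq_mul, Pi.smul_apply]
      ring
    · simp only [mlpGrad, hp, hmx, Sum.elim_inr, PiLp.smul_apply, smul_eq_mul, Pi.smul_apply]
      ring
  rw [ntkFeature, ntkFeature, ← MemLp.toLp_const_smul]
  exact MemLp.toLp_congr _ _ (Eventually.of_forall fun θ => congrFun h θ)

theorem ntkFeature_zero {c : ℝ} (hc : 0 ≤ c) :
    ntkFeature c hc (0 : EuclideanSpace ℝ (Fin d)) = 0 := by
  have h := ntkFeature_smul hc (k := 2) two_pos (0 : EuclideanSpace ℝ (Fin d))
  rw [smul_zero, two_smul] at h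
  simpa using h

/-- The gradient can jump at `x₀ ≠ 0` only for parameters whose pre-activation there vanishes, a
null set; dominated convergence does the rest. -/
theorem continuous_ntkFeature {c : ℝ} (hc : 0 ≤ c) :
    Continuous (ntkFeature (d := d) c hc) := by
  refine continuous_iff_continuousAt.2 fun x₀ => ?_
  have hcont : ∀ᵐ θ ∂(stdGaussian (Param d 1)), Tendsto (fun x => mlpGrad c θ x) (𝓝 x₀)
      (𝓝 (mlpGrad c θ x₀)) := by
    rcases eq_or_ne x₀ 0 with rfl | hx
    · refine Eventually.of_forall fun θ => ?_
      have h0 : mlpGrad c θ 0 = 0 := by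
        simpa using norm_mlpGrad_le hc θ 0
      rw [h0]
      refine squeeze_zero_norm (fun x => norm_mlpGrad_le hc θ x) ?_
      have : Continuous fun x : EuclideanSpace ℝ (Fin d) => Real.sqrt c * ‖x‖ * ‖θ‖ := by fun_prop
      simpa using this.tendsto 0
    · filter_upwards [ae_preact_ne_zero hx 0] with θ hθ
      have hp := fun r => (continuous_preact θ r).tendsto x₀
      refine ((PiLp.continuous_toLp 2 _).tendsto _).comp (tendsto_pi_nhds.2 fun i => ?_)
      refine Tendsto.const_mul _ ?_
      rcases i with ⟨r, j⟩ | r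
      · simp only [Sum.elim_inl]
        refine Tendsto.mul (Tendsto.const_mul _ ?_) (Continuous.tendsto (by fun_prop) _)
        rw [Subsingleton.elim r 0]
        rcases hθ.lt_or_gt with h | h
        · refine tendsto_const_nhds.congr' ?_
          filter_upwards [(hp 0).eventually (gt_mem_nhds h)] with x hx
          simp [h.not_gt, hx.not_gt]
        · refine tendsto_const_nhds.congr' ?_
          filter_upwards [(hp 0).eventually (lt_mem_nhds h)] with x hx
          simp [h, hx]
      · exact tendsto_const_nhds.max (hp r)
  rw [ContinuousAt, tendsto_iff_norm_sub_tendsto_zero]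
  have hsq : ∀ x, ‖ntkFeature c hc x - ntkFeature c hc x₀‖ ^ 2 =
      ∫ θ, ‖mlpGrad c θ x - mlpGrad c θ x₀‖ ^ 2 ∂(stdGaussian (Param d 1)) := fun x => by
    rw [ntkFeature, ntkFeature, ← MemLp.toLp_sub, ← real_inner_self_eq_norm_sq, inner_toLp]
    simp only [real_inner_self_eq_norm_sq, Pi.sub_apply]
  have hlim : Tendsto (fun x => ‖ntkFeature c hc x - ntkFeature c hc x₀‖ ^ 2) (𝓝 x₀) (𝓝 0) := by
    simp only [hsq]
    have hz : (0 : ℝ) = ∫ _, (0 : ℝ) ∂(stdGaussian (Param d 1)) := by simp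
    rw [hz]
    refine tendsto_integral_filter_of_dominated_convergence
      (fun θ => (Real.sqrt c * (2 * ‖x₀‖ + 1)) ^ 2 * ‖θ‖ ^ 2) (Eventually.of_forall fun x => ?_)
      ?_ ?_ ?_
    · exact (((measurable_mlpGrad c x).sub (measurable_mlpGrad c x₀)).norm.pow_const
        2).aestronglyMeasurable
    · filter_upwards [Metric.ball_mem_nhds x₀ one_pos] with x hx
      refine Eventually.of_forall fun θ => ?_
      rw [Real.norm_of_nonneg (by positivity), ← mul_pow]
      have hxn : ‖x‖ ≤ ‖x₀‖ + 1 := by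
        have := norm_le_norm_add_norm_sub x₀ x
        rw [← dist_eq_norm, dist_comm] at this
        linarith [Metric.mem_ball.1 hx]
      refine pow_le_pow_left₀ (norm_nonneg _) ?_ 2
      calc ‖mlpGrad c θ x - mlpGrad c θ x₀‖ ≤ ‖mlpGrad c θ x‖ + ‖mlpGrad c θ x₀‖ := norm_sub_le _ _
        _ ≤ Real.sqrt c * ‖x‖ * ‖θ‖ + Real.sqrt c * ‖x₀‖ * ‖θ‖ :=
          add_le_add (norm_mlpGrad_le hc θ x) (norm_mlpGrad_le hc θ x₀)
        _ ≤ Real.sqrt c * (‖x₀‖ + 1) * ‖θ‖ + Real.sqrt c * ‖x₀‖ * ‖θ‖ := by gcongr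
        _ = _ := by ring
    · exact ((IsGaussian.memLp_two_id (μ := stdGaussian (Param d 1))).integrable_norm_pow
        two_ne_zero).const_mul _
    · filter_upwards [hcont] with θ hθ
      simpa using ((hθ.sub_const (mlpGrad c θ x₀)).norm.pow 2)
  have := hlim.sqrt
  simpa [Real.sqrt_sq] using this

/-! ### Linear functions in the feature space. -/

theorem integral_sq_inr_stdGaussian (r : Fin m) :
    ∫ θ, θ (Sum.inr r) ^ 2 ∂(stdGaussian (Param d m)) = 1 := by
  have h := variance_dual_stdGaussian (E := Param d m)
    (innerSL ℝ (EuclideanSpace.single (Sum.inr r) (1 : ℝ)))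
  rw [variance_of_integral_eq_zero (by fun_prop) (integral_strongDual_stdGaussian _)] at h
  simpa [EuclideanSpace.inner_single_left] using h

/-- Half of the second moment of the output weight is carried by each half-space of hidden
weights. -/
theorem integral_sq_mul_step {x : EuclideanSpace ℝ (Fin d)} (hx : x ≠ 0) :
    ∫ θ, θ (Sum.inr 0) ^ 2 * (if 0 < preact θ x 0 then 1 else 0) ∂(stdGaussian (Param d 1))
      = 1 / 2 := by
  set γ := stdGaussian (Param d 1)
  set f : Param d 1 → ℝ := fun θ => θ (Sum.inr 0) ^ 2 * (if 0 < preact θ x 0 then 1 else 0)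
  have hsqi : Integrable (fun θ : Param d 1 => θ (Sum.inr 0) ^ 2) γ := by
    refine (((IsGaussian.memLp_two_id (μ := γ)).integrable_norm_pow two_ne_zero)).mono'
      (by fun_prop) (Eventually.of_forall fun θ => ?_)
    rw [norm_pow]
    exact pow_le_pow_left₀ (norm_nonneg _) (PiLp.norm_apply_le θ _) 2
  have hfm : Measurable f := Measurable.mul (by fun_prop)
    (Measurable.ite (measurableSet_lt measurable_const (measurable_preact x 0)) measurable_const
      measurable_const)
  have hfi : Integrable f γ := by
    refine hsqi.mono' hfm.aestronglyMeasurable (Eventually.of_forall fun θ => ?_)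
    simp only [f]
    split_ifs <;> simp [sq_nonneg]
  -- The reflection `θ ↦ -θ` swaps the two half-spaces and fixes the squared output weight.
  have hmp : MeasurePreserving (fun θ : Param d 1 => -θ) γ γ :=
    ⟨measurable_neg, stdGaussian_map (LinearIsometryEquiv.neg ℝ)⟩
  have hneg : ∫ θ, f (-θ) ∂γ = ∫ θ, f θ ∂γ := by
    conv_rhs => rw [← hmp.map_eq]
    rw [integral_map hmp.measurable.aemeasurable hfm.aestronglyMeasurable]
  have hsum : ∫ θ, f θ + f (-θ) ∂γ = 1 := by
    rw [← integral_sq_inr_stdGaussian (d := d) (0 : Fin 1)]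
    refine integral_congr_ae ?_
    filter_upwards [ae_preact_ne_zero hx 0] with θ hθ
    have hp : preact (-θ) x 0 = -preact θ x 0 := by simp [preact]
    simp only [f, hp]
    rcases hθ.lt_or_gt with h | h
    · simp [h, h.not_gt]
    · simp [h, h.not_gt]
  have hfi' : Integrable (fun θ => f (-θ)) γ := hmp.integrable_comp_of_integrable hfi
  rw [integral_add hfi hfi', hneg] at hsum
  linarith

/-- Linear functions belong to the reproducing kernel Hilbert space of the neural tangent
kernel. -/
theorem exists_inner_ntkFeature_eq {c : ℝ} (hc : 0 < c) (β : EuclideanSpace ℝ (Fin d)) :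
    ∃ h, ∀ x, inner ℝ (ntkFeature c hc.le x) h = inner ℝ β x := by
  -- The factor `2 / √c` cancels the scaling `√c` of the gradient and the mass `1 / 2` of the
  -- half-space.
  let g : Param d 1 → Param d 1 := fun θ => WithLp.toLp 2 fun i =>
    i.elim (fun p => 2 / Real.sqrt c * θ (Sum.inr 0) * β p.2) (fun _ => 0)
  have hsc : Real.sqrt c ≠ 0 := (Real.sqrt_pos.2 hc).ne'
  have hgm : Measurable g := by
    refine (PiLp.continuous_toLp 2 _).measurable.comp (measurable_pi_lambda _ fun i => ?_)
    rcases i with p | r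
    · simp only [Sum.elim_inl]; fun_prop
    · simp
  have hg : MemLp g 2 (stdGaussian (Param d 1)) := by
    refine (IsGaussian.memLp_two_id (μ := stdGaussian (Param d 1))).of_le_mul
      (c := 2 / Real.sqrt c * ‖β‖) hgm.aestronglyMeasurable (Eventually.of_forall fun θ => ?_)
    refine le_of_sq_le_sq ?_ (by positivity)
    have h1 : ‖g θ‖ ^ 2 = (2 / Real.sqrt c * ‖β‖) ^ 2 * ‖θ (Sum.inr 0)‖ ^ 2 := by
      rw [EuclideanSpace.real_norm_sq_eq, mul_pow, EuclideanSpace.real_norm_sq_eq β]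
      simp only [g, Fintype.sum_sum_type, Fintype.sum_prod_type, Sum.elim_inl, Sum.elim_inr,
        Finset.univ_unique, Finset.sum_singleton, Real.norm_eq_abs, sq_abs, Finset.mul_sum,
        Finset.sum_mul]
      simp only [ne_eq, OfNat.ofNat_ne_zero, not_false_eq_true, zero_pow, add_zero]
      exact Finset.sum_congr rfl fun j _ => by ring
    rw [h1, mul_pow (2 / Real.sqrt c * ‖β‖)]
    exact mul_le_mul_of_nonneg_left (pow_le_pow_left₀ (norm_nonneg _) (PiLp.norm_apply_le θ _) 2)
      (by positivity)
  refine ⟨hg.toLp g, fun x => ?_⟩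
  rcases eq_or_ne x 0 with rfl | hx
  · simp [ntkFeature_zero]
  rw [ntkFeature, inner_toLp]
  have h2 : ∀ θ : Param d 1, inner ℝ (mlpGrad c θ x) (g θ) =
      2 * inner ℝ β x * (θ (Sum.inr 0) ^ 2 * (if 0 < preact θ x 0 then 1 else 0)) := fun θ => by
    simp only [PiLp.inner_apply, Fintype.sum_sum_type, Fintype.sum_prod_type, mlpGrad, g,
      RCLike.inner_apply, conj_trivial, Sum.elim_inl, Sum.elim_inr, Finset.univ_unique,
      Finset.sum_singleton, Fin.default_eq_zero, Fin.isValue, Nat.cast_one, div_one, zero_mul,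
      add_zero, Finset.mul_sum, Finset.sum_mul]
    refine Finset.sum_congr rfl fun j _ => ?_
    field_simp
  simp only [h2, integral_const_mul, integral_sq_mul_step hx]
  ring

/-! ### The learned function as a projection. -/

/-- The function learned in the NTK regime from noiseless labels `⟪ntkFeature c (X i), h⟫` is
represented by the projection of `h` onto the span of the features of the training points. -/
theorem isLearned_iff {c : ℝ} (hc : 0 ≤ c) {n : ℕ} (X : Fin n → EuclideanSpace ℝ (Fin d))
    (h : Lp (Param d 1) 2 (stdGaussian (Param d 1))) (f : EuclideanSpace ℝ (Fin d) → ℝ) :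
    IsLearned c X (fun i => inner ℝ (ntkFeature c hc (X i)) h) f ↔
      f = fun x => inner ℝ (ntkFeature c hc x)
        ((Submodule.span ℝ (Set.range fun i => ntkFeature c hc (X i))).starProjection h) := by
  obtain ⟨F, hF, hFlim⟩ := exists_isKernelGradientFlow (ntkFeature c hc) h X
  constructor
  · rintro ⟨K, hK, G, hG, hGlim⟩
    obtain rfl : K = fun x x' => inner ℝ (ntkFeature c hc x) (ntkFeature c hc x') := by
      ext x x'
      exact tendsto_nhds_unique (hK x x') (isNTK_inner_ntkFeature hc x x')
    ext x
    refine tendsto_nhds_unique (hGlim x) ((hFlim x).congr' ?_)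
    filter_upwards [eventually_ge_atTop 0] with t ht
    exact hF.eq hG ht x
  · rintro rfl
    exact ⟨_, isNTK_inner_ntkFeature hc, F, hF, hFlim⟩

/-! ### Density of the sample and convergence of projections. -/

/-- Almost surely, the support of the law is contained in the closure of an i.i.d. sample. -/
theorem ae_support_subset_closure_range {E Ω : Type*} [TopologicalSpace E]
    [SecondCountableTopology E] [MeasurableSpace E] [BorelSpace E] [MeasurableSpace Ω]
    {P : Measure Ω} [IsProbabilityMeasure P] {μ : Measure E} {X : ℕ → Ω → E}
    (hlaw : ∀ i, HasLaw (X i) μ P) (hindep : iIndepFun X P) :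
    ∀ᵐ ω ∂P, μ.support ⊆ closure (Set.range fun i => X i ω) := by
  have : IsProbabilityMeasure μ := (hlaw 0).map_eq ▸ Measure.isProbabilityMeasure_map
    (hlaw 0).aemeasurable
  have hU : ∀ U ∈ TopologicalSpace.countableBasis E, ∀ᵐ ω ∂P, 0 < μ U → ∃ i, X i ω ∈ U := by
    intro U hU
    by_cases hpos : 0 < μ U
    swap
    · exact Eventually.of_forall fun ω h => absurd h hpos
    have hUm : MeasurableSet U := (TopologicalSpace.isOpen_of_mem_countableBasis hU).measurableSet
    have hlt : μ Uᶜ < 1 := by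
      rw [prob_compl_eq_one_sub hUm]
      exact ENNReal.sub_lt_self ENNReal.one_ne_top one_ne_zero hpos.ne'
    -- By independence, `n` samples all miss `U` with probability `μ Uᶜ ^ n`, which tends to zero.
    have hle : ∀ n : ℕ, P {ω | ¬ (0 < μ U → ∃ i, X i ω ∈ U)} ≤ μ Uᶜ ^ n := fun n => by
      have h1 := hindep.measure_inter_preimage_eq_mul (Finset.range n) (sets := fun _ => Uᶜ)
        fun _ _ => hUm.compl
      have h2 : ∀ i, P (X i ⁻¹' Uᶜ) = μ Uᶜ := fun i => (hlaw i).measure_eq hUm.compl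
      rw [Finset.prod_congr rfl fun i _ => h2 i, Finset.prod_const, Finset.card_range] at h1
      rw [← h1]
      refine measure_mono fun ω hω => ?_
      simp only [Set.mem_ofPred_eq, not_forall, not_exists] at hω
      simp only [Set.mem_iInter]
      exact fun i _ => hω.2 i
    exact le_antisymm (ge_of_tendsto' (ENNReal.tendsto_pow_atTop_nhds_zero_of_lt_one hlt) hle)
      zero_le
  filter_upwards [(ae_ball_iff (TopologicalSpace.countable_countableBasis E)).2 hU] with ω hω x hx
  refine (TopologicalSpace.isBasis_countableBasis E).mem_closure_iff.2 fun U hUb hxU => ?_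
  obtain ⟨i, hi⟩ := hω U hUb ((Measure.mem_support_iff_forall x).1 hx U
    ((TopologicalSpace.isOpen_of_mem_countableBasis hUb).mem_nhds hxU))
  exact ⟨X i ω, hi, i, rfl⟩

/-- If a set meeting every open ray lies in the closure of the sample, then all features lie in
the closed span of the features of the sample. -/
theorem ntkFeature_mem_topologicalClosure {c : ℝ} (hc : 0 ≤ c) {S : Set (EuclideanSpace ℝ (Fin d))}
    (hS : ∀ w : EuclideanSpace ℝ (Fin d), w ≠ 0 → ∃ k : ℝ, 0 < k ∧ k • w ∈ S)
    {X : ℕ → EuclideanSpace ℝ (Fin d)} (hX : S ⊆ closure (Set.range X))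
    (x : EuclideanSpace ℝ (Fin d)) :
    ntkFeature c hc x ∈
      (Submodule.span ℝ (Set.range fun i => ntkFeature c hc (X i))).topologicalClosure := by
  set M := (Submodule.span ℝ (Set.range fun i => ntkFeature c hc (X i))).topologicalClosure
  have hcl : IsClosed (ntkFeature c hc ⁻¹'
      (M : Set (Lp (Param d 1) 2 (stdGaussian (Param d 1))))) :=
    (Submodule.isClosed_topologicalClosure _).preimage (continuous_ntkFeature hc)
  have hsub : closure (Set.range X) ⊆ ntkFeature c hc ⁻¹'
      (M : Set (Lp (Param d 1) 2 (stdGaussian (Param d 1)))) :=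
    hcl.closure_subset_iff.2 <| Set.range_subset_iff.2 fun i =>
      Submodule.le_topologicalClosure _ (Submodule.subset_span ⟨i, rfl⟩)
  rcases eq_or_ne x 0 with rfl | hx
  · rw [ntkFeature_zero]
    exact M.zero_mem
  obtain ⟨k, hk, hkx⟩ := hS x hx
  have h1 : ntkFeature c hc (k • x) ∈ M := hsub (hX hkx)
  rw [ntkFeature_smul hc hk] at h1
  exact (M.smul_mem_iff hk.ne').1 h1

/-- Elements of a closed span of a sequence are approximated by rational combinations. -/
theorem exists_rat_combination_lt {H : Type*} [NormedAddCommGroup H] [NormedSpace ℝ H] {v : ℕ → H}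
    {h : H} (hh : h ∈ (Submodule.span ℝ (Set.range v)).topologicalClosure) {ε : ℝ} (hε : 0 < ε) :
    ∃ p : Finset ℕ × (ℕ →₀ ℚ), ‖h - ∑ i ∈ p.1, (p.2 i : ℝ) • v i‖ < ε := by
  obtain ⟨w, hw, hwε⟩ := Metric.mem_closure_iff.1 hh ε hε
  obtain ⟨r, rfl⟩ := (Finsupp.mem_span_range_iff_exists_finsupp).1 hw
  have hd : DenseRange (fun (a : ℕ → ℚ) (i : ℕ) => (a i : ℝ)) :=
    DenseRange.piMap fun _ => Rat.denseRange_cast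
  -- Strict approximation is an open condition on the coefficients, so rational ones suffice.
  have ho : IsOpen {a : ℕ → ℝ | ‖h - ∑ i ∈ r.support, a i • v i‖ < ε} :=
    isOpen_lt (by fun_prop) continuous_const
  obtain ⟨a, ha⟩ := hd.exists_mem_open ho ⟨r, by rwa [dist_eq_norm] at hwε⟩
  refine ⟨(r.support, Finsupp.onFinset r.support (fun i => if i ∈ r.support then a i else 0)
    fun i hi => by by_contra h; simp [h] at hi), ?_⟩
  refine lt_of_eq_of_lt ?_ ha
  congr 2
  refine Finset.sum_congr rfl fun i hi => ?_
  simp only [Finsupp.onFinset_apply, if_pos hi]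

/-- The projections of `h` onto the spans of the first `n` terms of a random sequence converge to
`h` in probability if `h` is almost surely in the closed span of the sequence. -/
theorem tendsto_measure_projection_error {Ω H : Type*} [MeasurableSpace Ω] {P : Measure Ω}
    [IsProbabilityMeasure P] [NormedAddCommGroup H] [InnerProductSpace ℝ H] {v : ℕ → Ω → H}
    (hv : ∀ i, AEStronglyMeasurable (v i) P) {h : H}
    (hh : ∀ᵐ ω ∂P, h ∈ (Submodule.span ℝ (Set.range fun i => v i ω)).topologicalClosure)
    {ε : ℝ} (hε : 0 < ε) :
    Tendsto (fun n => P {ω | ε ≤ ‖h - (Submodule.span ℝ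
      (Set.range fun i : Fin n => v i ω)).starProjection h‖}) atTop (𝓝 0) := by
  let q : Finset ℕ × (ℕ →₀ ℚ) → Ω → ℝ := fun p ω => ‖h - ∑ i ∈ p.1, (p.2 i : ℝ) • v i ω‖
  -- Countably many rational combinations make `A n` null-measurable, so continuity from above
  -- applies. The projection minimizes the distance, so `A n` contains the error event.
  let A : ℕ → Set Ω := fun n => ⋂ p : {p : Finset ℕ × (ℕ →₀ ℚ) // p.1 ⊆ Finset.range n},
    {ω | ε ≤ q p ω}
  have hA : ∀ n, NullMeasurableSet (A n) P := fun n => by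
    refine NullMeasurableSet.iInter fun p => ?_
    have hq : AEStronglyMeasurable (q p) P :=
      (aestronglyMeasurable_const.sub (Finset.aestronglyMeasurable_fun_sum _ fun i _ =>
        (hv i).const_smul _)).norm
    exact hq.aemeasurable.nullMeasurable measurableSet_Ici
  have hanti : Antitone A := fun n m hnm ω hω => by
    simp only [A, Set.mem_iInter] at hω ⊢
    exact fun p => hω ⟨p.1, p.2.trans (Finset.range_subset_range.2 hnm)⟩
  have hinter : P (⋂ n, A n) = 0 := by
    rw [measure_eq_zero_iff_ae_notMem]
    filter_upwards [hh] with ω hω hmem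
    obtain ⟨p, hp⟩ := exists_rat_combination_lt hω hε
    obtain ⟨n, hn⟩ := p.1.exists_nat_subset_range
    have := Set.mem_iInter.1 (Set.mem_iInter.1 hmem n) ⟨p, hn⟩
    exact absurd hp (not_lt.2 this)
  have hlim := tendsto_measure_iInter_atTop (μ := P) hA hanti ⟨0, measure_ne_top _ _⟩
  rw [hinter] at hlim
  refine tendsto_of_tendsto_of_tendsto_of_le_of_le tendsto_const_nhds hlim (fun _ => zero_le)
    fun n => measure_mono fun ω hω => Set.mem_iInter.2 fun p => ?_
  have hmem : ∑ i ∈ p.1.1, (p.1.2 i : ℝ) • v i ω ∈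
      Submodule.span ℝ (Set.range fun i : Fin n => v i ω) :=
    Submodule.sum_mem _ fun i hi => Submodule.smul_mem _ _
      (Submodule.subset_span ⟨⟨i, Finset.mem_range.1 (p.2 hi)⟩, rfl⟩)
  refine le_trans (Set.mem_ofPred_eq ▸ hω) ?_
  rw [Submodule.starProjection_minimal]
  exact ciInf_le ⟨0, by rintro _ ⟨w, rfl⟩; positivity⟩
    (⟨_, hmem⟩ : Submodule.span ℝ (Set.range fun i : Fin n => v i ω))

/-- Linear functions are represented by an element of the closed span of the features. -/
theorem exists_inner_ntkFeature_eq_mem_closure {c : ℝ} (hc : 0 < c)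
    (β : EuclideanSpace ℝ (Fin d)) :
    ∃ h ∈ (Submodule.span ℝ (Set.range (ntkFeature (d := d) c hc.le))).topologicalClosure,
      ∀ x, inner ℝ (ntkFeature c hc.le x) h = inner ℝ β x := by
  obtain ⟨h, hh⟩ := exists_inner_ntkFeature_eq hc β
  set M := (Submodule.span ℝ (Set.range (ntkFeature (d := d) c hc.le))).topologicalClosure
  -- Discarding the part of `h` orthogonal to all features leaves the represented function
  -- unchanged.
  refine ⟨M.starProjection h, M.starProjection_apply_mem h, fun x => ?_⟩
  have hx : ntkFeature c hc.le x ∈ M :=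
    Submodule.le_topologicalClosure _ (Submodule.subset_span ⟨x, rfl⟩)
  have := M.starProjection_inner_eq_zero h _ hx
  rw [inner_sub_left, sub_eq_zero] at this
  rw [← hh, real_inner_comm, ← this, real_inner_comm]

end ReLUNTK

theorem theorem2 {d : ℕ} (c : ℝ) (hc : 0 < c) (β : EuclideanSpace ℝ (Fin d))
    {Ω : Type*} [MeasurableSpace Ω] (P : Measure Ω) [IsProbabilityMeasure P]
    (μ : Measure (EuclideanSpace ℝ (Fin d)))
    (X : ℕ → Ω → EuclideanSpace ℝ (Fin d))
    (hlaw : ∀ i, HasLaw (X i) μ P) (hindep : iIndepFun X P)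
    (hsupp : ∃ S ⊆ μ.support, IsConnected S ∧
      ∀ w : EuclideanSpace ℝ (Fin d), w ≠ 0 → ∃ k : ℝ, 0 < k ∧ k • w ∈ S) :
    (∀ (n : ℕ) (ω : Ω), ∃! f : EuclideanSpace ℝ (Fin d) → ℝ,
      ReLUNTK.IsLearned c (fun i : Fin n => X i ω) (fun i : Fin n => inner ℝ β (X i ω)) f) ∧
    ∀ f : ℕ → Ω → EuclideanSpace ℝ (Fin d) → ℝ,
      (∀ n ω, ReLUNTK.IsLearned c (fun i : Fin n => X i ω)
        (fun i : Fin n => inner ℝ β (X i ω)) (f n ω)) →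
      ∀ x : EuclideanSpace ℝ (Fin d),
        TendstoInMeasure P (fun n ω => f n ω x) atTop (fun _ => inner ℝ β x) := by
  obtain ⟨h, hhM, hβ⟩ := ReLUNTK.exists_inner_ntkFeature_eq_mem_closure hc β
  simp only [← hβ, ReLUNTK.isLearned_iff hc.le]
  refine ⟨fun n ω => ⟨_, rfl, fun _ hf => hf⟩, fun f hf x => ?_⟩
  obtain ⟨S, hSμ, -, hS⟩ := hsupp
  set φ := ReLUNTK.ntkFeature (d := d) c hc.le
  have hmem : ∀ᵐ ω ∂P,
      h ∈ (Submodule.span ℝ (Set.range fun i => φ (X i ω))).topologicalClosure := by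
    filter_upwards [ReLUNTK.ae_support_subset_closure_range hlaw hindep] with ω hω
    refine Submodule.topologicalClosure_minimal _ (Submodule.span_le.2 ?_)
      (Submodule.isClosed_topologicalClosure _) hhM
    rintro _ ⟨z, rfl⟩
    exact ReLUNTK.ntkFeature_mem_topologicalClosure hc.le hS (hSμ.trans hω) z
  have hmeas : ∀ i, AEStronglyMeasurable (fun ω => φ (X i ω)) P := fun i =>
    (ReLUNTK.continuous_ntkFeature hc.le).comp_aestronglyMeasurable
      (hlaw i).aemeasurable.aestronglyMeasurable
  refine tendstoInMeasure_iff_dist.2 fun ε hε => ?_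
  -- The summand `1` keeps the threshold `ε / (‖φ x‖ + 1)` meaningful when `φ x = 0`.
  have hpos : 0 < ‖φ x‖ + 1 := by positivity
  refine tendsto_of_tendsto_of_tendsto_of_le_of_le tendsto_const_nhds
    (ReLUNTK.tendsto_measure_projection_error hmeas hmem (div_pos hε hpos)) (fun _ => zero_le)
    fun n => measure_mono fun ω hω => ?_
  simp only [Set.mem_ofPred_eq, hf, dist_eq_norm, ← inner_sub_right] at hω
  rw [Set.mem_ofPred_eq, div_le_iff₀ hpos, norm_sub_rev, mul_comm]
  exact (hω.trans (norm_inner_le_norm _ _)).trans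
    (mul_le_mul_of_nonneg_right (by linarith) (norm_nonneg _))
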